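/- Let $r\in\{1,2,3,\ldots\}\cup\{\infty\}$, let $E$ be a Hausdorff real locally convex topological vector space and let $M$ be a Hausdorff $C^r$-manifold modelled on $E$ (with $C^r$-maps between open subsets of locally convex spaces understood in the sense of Michal–Bastiani: a map $f\colon U\to F$ is $C^0$ if it is continuous, and $C^{k+1}$ if it is continuous, all directional derivatives $df(x,y)=\frac{d}{dt}\big|_{t=0}f(x+ty)$ with $x\in U$, $y\in E$ exist, and $df\colon U\times E\to F$ is $C^k$; it is $C^\infty$ if it is $C^k$ for all $k$). Assume that $M$ is $C^r$-regular, i.e. the topology of $M$ is the initial topology with respect to the set $C^r(M,\mathbb R)$ of all real-valued $C^r$-functions on $M$. Then there exists a $C^r$-embedding $$\theta\colon M\to (E\times\mathbb R)^M,$$ where $(E\times\mathbb R)^M$ is the locally convex direct product of copies of $E\times \mathbb R$ indexed by the points of $M$. Here a $C^r$-map $f\colon M\to N$ between $C^r$-manifolds modelled on $E$ and $F$ is a $C^r$-embedding if it is a homeomorphism onto its image and a $C^r$-immersion; the latter means that for each $x\in M$ there are charts $\phi\colon U_\phi\to V_\phi\subseteq E$ of $M$ with $x\in U_\phi$ and $\psi\colon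 U_\psi\to V_\psi\subseteq F$ of $N$ with $f(x)\in U_\psi$ such that $f(U_\phi)\subseteq U_\psi$ and $\psi\circ f\circ\phi^{-1}=j|_{V_\phi}$ for a linear map $j\colon E\to F$ which is a topological embedding onto a vector subspace of $F$ that is complemented as a topological vector space. -/

import Mathlib

open Filter Topology Set

universe u v w

/-- `HasDirDeriv f L x y`: the real directional derivative `d/dt f (x + t y)` at `t = 0`
exists in the topological vector space `F` and equals `L`. -/
def HasDirDeriv {E : Type u} [AddCommGroup E] [Module ℝ E]
    {F : Type v} [AddCommGroup F] [Module ℝ F] [TopologicalSpace F]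
    (f : E → F) (L : F) (x y : E) : Prop :=
  Tendsto (fun t : ℝ => t⁻¹ • (f (x + t • y) - f x)) (𝓝[≠] 0) (𝓝 L)

/-- The map `f` is of class `C^k` (`k` a natural number) on the open set `U` in the sense of
Michal-Bastiani (Keller's `C^k_c`): it is continuous on `U` and, if `k = n + 1`,
the directional derivatives `df (x, y)` exist for all `x ∈ U` and `y ∈ E`, and the map
`df : U × E → F` is of class `C^n`. This notion is only used for open sets `U`; it does not depend
on the values of `f` off `U`. -/
def IsCkOn : ℕ → ∀ {E : Type u} [AddCommGroup E] [Module ℝ E] [TopologicalSpace E]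
    {F : Type v} [AddCommGroup F] [Module ℝ F] [TopologicalSpace F], (E → F) → Set E → Prop
  | 0, _, _, _, _, _, _, _, _, f, U => ContinuousOn f U
  | n + 1, E, _, _, _, F, _, _, _, f, U => ContinuousOn f U ∧
      ∃ df : E × E → F, (∀ x ∈ U, ∀ y : E, HasDirDeriv f (df (x, y)) x y) ∧
        IsCkOn n df (U ×ˢ (univ : Set E))

/-- The map `f` is of class `C^r` on the open set `U`, where `r` is a natural number or `∞`. -/
def IsCrOn (r : ℕ∞) {E : Type u} [AddCommGroup E] [Module ℝ E] [TopologicalSpace E]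
    {F : Type v} [AddCommGroup F] [Module ℝ F] [TopologicalSpace F]
    (f : E → F) (U : Set E) : Prop :=
  ∀ k : ℕ, (k : ℕ∞) ≤ r → IsCkOn k f U

/-- The atlas of the charted space `M` is a `C^r`-atlas: all changes of charts are `C^r`. -/
class IsCrManifold (r : ℕ∞) (E : Type u) [AddCommGroup E] [Module ℝ E] [TopologicalSpace E]
    (M : Type w) [TopologicalSpace M] [ChartedSpace E M] : Prop where
  compatible : ∀ φ ∈ atlas E M, ∀ ψ ∈ atlas E M, IsCrOn r (φ.symm.trans ψ) (φ.symm.trans ψ).source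

/-- The charts of `M` as a `C^r`-manifold, i.e. the elements of the maximal `C^r`-atlas:
all homeomorphisms from an open subset of `M` onto an open subset of `E` which are
`C^r`-compatible with the charts of the given atlas. -/
def crCharts (r : ℕ∞) (E : Type u) [AddCommGroup E] [Module ℝ E] [TopologicalSpace E]
    (M : Type w) [TopologicalSpace M] [ChartedSpace E M] : Set (OpenPartialHomeomorph M E) :=
  {φ | ∀ ψ ∈ atlas E M, IsCrOn r (φ.symm.trans ψ) (φ.symm.trans ψ).source ∧
    IsCrOn r (ψ.symm.trans φ) (ψ.symm.trans φ).source}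

section Maps

variable (r : ℕ∞)
  (E : Type u) [AddCommGroup E] [Module ℝ E] [TopologicalSpace E]
  (F : Type v) [AddCommGroup F] [Module ℝ F] [TopologicalSpace F]
  {M : Type*} [TopologicalSpace M] [ChartedSpace E M]
  {N : Type*} [TopologicalSpace N] [ChartedSpace F N]

/-- `C^r`-maps between manifolds modelled on `E` and `F`: continuous maps `f` such that
`ψ ∘ f ∘ φ⁻¹` is `C^r` on the open set where it is defined, for all charts `φ` and `ψ`. -/
def IsCrMap (f : M → N) : Prop :=
  Continuous f ∧ ∀ φ ∈ crCharts r E M, ∀ ψ ∈ crCharts r F N,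
    IsCrOn r (ψ ∘ f ∘ φ.symm) (φ.target ∩ φ.symm ⁻¹' (f ⁻¹' ψ.source))

/-- `C^r`-immersions: `C^r`-maps which, around each point and in suitable charts, are the
restriction of a linear topological embedding onto a complemented vector subspace. -/
def IsCrImmersion (f : M → N) : Prop :=
  IsCrMap r E F f ∧ ∀ x : M, ∃ φ ∈ crCharts r E M, ∃ ψ ∈ crCharts r F N,
    x ∈ φ.source ∧ f x ∈ ψ.source ∧ f '' φ.source ⊆ ψ.source ∧
    ∃ j : E →ₗ[ℝ] F, IsEmbedding j ∧ (∃ C : Submodule ℝ F, (LinearMap.range j).IsTopCompl C) ∧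
      ∀ z ∈ φ.target, ψ (f (φ.symm z)) = j z

/-- `C^r`-embeddings: `C^r`-immersions which are topological embeddings. -/
def IsCrEmbedding (f : M → N) : Prop :=
  IsCrImmersion r E F f ∧ IsEmbedding f

variable (M) in
/-- A `C^r`-manifold `M` is `C^r`-regular if its topology is initial with respect to the set
of all real-valued `C^r`-functions on `M`. -/
def IsCrRegular : Prop :=
  ‹TopologicalSpace M› =
    ⨅ f : {f : M → ℝ // IsCrMap r E ℝ f}, TopologicalSpace.induced f.1 inferInstance

end Maps

/-! Regularity provides, for each `x`, a `C^r` bump `ξ x` that equals 1 near `x` and has closed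
support inside the domain of a chart `φ x`. The embedding sends `y` to the family `(ξ x y • φ x y, ξ
x y)` indexed by `x`.

Immersion: near `x`, the continuous linear projection `p` onto the `E`-part of coordinate `x` turns
`θ` into `φ x`. With `j` the inclusion of that factor, `θ ∘ (φ x)⁻¹` and `j` are both sections of
`p`, so their difference lies in `ker p` and a shear carries one to the other. No inverse function
theorem is needed (`isCrImmersion_of_exists_clm_eqOn_chart`).

Embedding: where `ξ x y ≠ 0`, the point `y` lies in the chart domain, and dividing the first
component by the second recovers `φ x y`. So `θ` induces the topology of `M`.

The calculus rests on the chain rule, which follows from a Hahn-Banach mean value theorem; no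
integrals, hence no completeness, enter. -/

/-! ### Directional derivatives, mean value theorem, pointwise chain rule -/

section DirectionalDerivative

variable {E : Type u} [AddCommGroup E] [Module ℝ E]
  {F : Type v} [AddCommGroup F] [Module ℝ F] [TopologicalSpace F]
  {G : Type w} [AddCommGroup G] [Module ℝ G] [TopologicalSpace G]

theorem HasDirDeriv.unique [T2Space F] {f : E → F} {L L' : F} {x y : E}
    (h : HasDirDeriv f L x y) (h' : HasDirDeriv f L' x y) : L = L' :=
  tendsto_nhds_unique h h'

theorem HasDirDeriv.clm_comp {f : E → F} {D : F} {x y : E} (h : HasDirDeriv f D x y)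
    (L : F →L[ℝ] G) : HasDirDeriv (fun z => L (f z)) (L D) x y := by
  refine ((L.continuous.tendsto D).comp h).congr fun t => ?_
  simp

theorem HasDirDeriv.prodMk {f : E → F} {g : E → G} {D : F} {D' : G} {x y : E}
    (hf : HasDirDeriv f D x y) (hg : HasDirDeriv g D' x y) :
    HasDirDeriv (fun z => (f z, g z)) (D, D') x y :=
  (Tendsto.prodMk_nhds hf hg).congr fun t => by simp

theorem hasDirDeriv_pi {ι : Type*} {f : E → ι → F} {D : ι → F} {x y : E}
    (h : ∀ i, HasDirDeriv (fun z => f z i) (D i) x y) : HasDirDeriv f D x y :=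
  tendsto_pi_nhds.2 h

theorem HasDirDeriv.hasDerivAt_line {f : E → ℝ} {D : ℝ} {z y : E} {s : ℝ}
    (h : HasDirDeriv f D (z + s • y) y) : HasDerivAt (fun τ : ℝ => f (z + τ • y)) D s := by
  rw [hasDerivAt_iff_tendsto_slope_zero]
  refine Tendsto.congr (fun t => ?_) h
  rw [add_smul, add_assoc]

/-- A mean value theorem: difference quotients along a segment lie in each closed convex set
which contains the directional derivatives along the segment. -/
theorem slope_mem_of_hasDirDeriv_mem [IsTopologicalAddGroup F] [ContinuousSMul ℝ F]
    [LocallyConvexSpace ℝ F] {f : E → F} {D : E → F} {z y : E} {t : ℝ} (ht : t ≠ 0) {C : Set F}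
    (hC : Convex ℝ C) (hC' : IsClosed C)
    (hD : ∀ s ∈ Icc (0 : ℝ) 1, HasDirDeriv f (D (z + (s * t) • y)) (z + (s * t) • y) y)
    (hDC : ∀ s ∈ Icc (0 : ℝ) 1, D (z + (s * t) • y) ∈ C) :
    t⁻¹ • (f (z + t • y) - f z) ∈ C := by
  by_contra hn
  -- A functional `l` strictly separating the quotient from `C` contradicts the scalar mean value
  -- theorem for `l ∘ f`.
  obtain ⟨l, u, hl, hu⟩ := geometric_hahn_banach_closed_point hC hC' hn
  have hder (s : ℝ) (hs : s ∈ Icc (0 : ℝ) 1) :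
      HasDerivAt (fun s : ℝ => l (f (z + (s * t) • y))) (l (D (z + (s * t) • y)) * t) s :=
    HasDerivAt.comp (h₂ := fun τ : ℝ => l (f (z + τ • y))) s
      ((hD s hs).clm_comp l).hasDerivAt_line (hasDerivAt_mul_const t)
  obtain ⟨s, hs, hs'⟩ := exists_hasDerivAt_eq_slope _ _ zero_lt_one
    (fun s hs => (hder s hs).continuousAt.continuousWithinAt)
    (fun s hs => hder s (Ioo_subset_Icc_self hs))
  have h1 := hl _ (hDC s (Ioo_subset_Icc_self hs))
  have h2 : l (t⁻¹ • (f (z + t • y) - f z)) = l (D (z + (s * t) • y)) := by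
    simp only [one_mul, zero_mul, zero_smul, add_zero, sub_zero, div_one] at hs'
    rw [map_smul, map_sub, ← hs', smul_eq_mul]
    field_simp
  rw [h2] at hu
  exact lt_asymm h1 hu

theorem exists_mem_nhds_isClosed_convex_subset [IsTopologicalAddGroup F] [ContinuousSMul ℝ F]
    [LocallyConvexSpace ℝ F] {a : F} {W : Set F} (hW : W ∈ 𝓝 a) :
    ∃ C ∈ 𝓝 a, IsClosed C ∧ Convex ℝ C ∧ C ⊆ W := by
  obtain ⟨K, hK, hKc, hKW⟩ := exists_mem_nhds_isClosed_subset hW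
  obtain ⟨C, ⟨hC, hC'⟩, hCK⟩ := (LocallyConvexSpace.convex_basis (𝕜 := ℝ) a).mem_iff.1 hK
  exact ⟨closure C, mem_of_superset hC subset_closure, isClosed_closure, hC'.closure,
    (closure_minimal hCK hKc).trans hKW⟩

/-- The quotient of `g ∘ f` is a quotient of `g` at `f x` in the moving direction `y'`, the quotient
of `f`. Since `y'` tends to `D`, continuity of `dg` keeps the derivatives along the segment in a
closed convex neighbourhood of `dg (f x, D)`, and the mean value theorem applies. -/
theorem HasDirDeriv.comp [IsTopologicalAddGroup F] [ContinuousSMul ℝ F]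
    [IsTopologicalAddGroup G] [ContinuousSMul ℝ G] [LocallyConvexSpace ℝ G]
    {f : E → F} {g : F → G} {D : F} {dg : F × F → G} {x y : E} {V : Set F} (hV : IsOpen V)
    (hx : f x ∈ V) (hf : HasDirDeriv f D x y)
    (hg : ∀ z ∈ V, ∀ w, HasDirDeriv g (dg (z, w)) z w) (hdg : ContinuousOn dg (V ×ˢ univ)) :
    HasDirDeriv (fun z => g (f z)) (dg (f x, D)) x y := by
  refine tendsto_def.2 fun W hW => ?_
  obtain ⟨C, hC, hCc, hCv, hCW⟩ := exists_mem_nhds_isClosed_convex_subset hW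
  have hc : ContinuousAt (fun p : ℝ × F => (f x + p.1 • p.2, p.2)) (0, D) := by fun_prop
  have hmem : V ×ˢ univ ∩ dg ⁻¹' C ∈ 𝓝 (f x, D) := by
    have hVn : V ×ˢ (univ : Set F) ∈ 𝓝 (f x, D) := (hV.prod isOpen_univ).mem_nhds ⟨hx, trivial⟩
    exact inter_mem hVn (hdg.continuousAt hVn hC)
  have hev : ∀ᶠ p : ℝ × F in 𝓝 (0, D), (f x + p.1 • p.2, p.2) ∈ V ×ˢ univ ∩ dg ⁻¹' C :=
    hc (by simpa using hmem)
  rw [nhds_prod_eq, eventually_prod_iff] at hev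
  obtain ⟨p, hp, q, hq, hpq⟩ := hev
  obtain ⟨ε, hε, hball⟩ := Metric.eventually_nhds_iff.1 hp
  have hsmall : ∀ᶠ t : ℝ in 𝓝[≠] 0, dist t 0 < ε :=
    nhdsWithin_le_nhds (Metric.ball_mem_nhds 0 hε)
  filter_upwards [hsmall, hf.eventually hq, self_mem_nhdsWithin] with t ht hqt ht0
  have ht0 : t ≠ 0 := ht0
  refine hCW ?_
  set y' := t⁻¹ • (f (x + t • y) - f x) with hy'
  have hfx : f (x + t • y) = f x + t • y' := by
    rw [hy', smul_smul, mul_inv_cancel₀ ht0, one_smul, add_sub_cancel]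
  have hin (s : ℝ) (hs : s ∈ Icc (0 : ℝ) 1) :
      (f x + (s * t) • y', y') ∈ V ×ˢ univ ∩ dg ⁻¹' C := by
    refine hpq (hball ?_) hqt
    rw [dist_zero_right, norm_mul] at *
    refine lt_of_le_of_lt ?_ ht
    rw [Real.norm_of_nonneg hs.1]
    exact mul_le_of_le_one_left (norm_nonneg t) hs.2
  show t⁻¹ • (g (f (x + t • y)) - g (f x)) ∈ C
  rw [hfx]
  exact slope_mem_of_hasDirDeriv_mem (D := fun z => dg (z, y')) ht0 hCv hCc
    (fun s hs => hg _ (hin s hs).1.1 _) fun s hs => (hin s hs).2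

end DirectionalDerivative

/-! ### Calculus of Michal-Bastiani maps -/

section Calculus

variable {E : Type u} [AddCommGroup E] [Module ℝ E] [TopologicalSpace E]
  {F : Type v} [AddCommGroup F] [Module ℝ F] [TopologicalSpace F]
  {G : Type w} [AddCommGroup G] [Module ℝ G] [TopologicalSpace G]

theorem eventually_add_smul_mem [ContinuousAdd E] [ContinuousSMul ℝ E] {U : Set E} {x : E}
    (hU : U ∈ 𝓝 x) (y : E) : ∀ᶠ t : ℝ in 𝓝 0, x + t • y ∈ U := by
  have h : ContinuousAt (fun t : ℝ => x + t • y) 0 := by fun_prop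
  exact h (by simpa using hU)

theorem HasDirDeriv.congr_of_mem [ContinuousAdd E] [ContinuousSMul ℝ E] {f g : E → F} {L : F}
    {x y : E} {U : Set E} (h : HasDirDeriv f L x y) (hU : IsOpen U) (hx : x ∈ U)
    (hfg : EqOn f g U) : HasDirDeriv g L x y := by
  refine Tendsto.congr' ?_ h
  filter_upwards [nhdsWithin_le_nhds (eventually_add_smul_mem (hU.mem_nhds hx) y)] with t ht
  rw [hfg ht, hfg hx]

theorem ContinuousLinearMap.hasDirDeriv (L : E →L[ℝ] F) (x y : E) :
    HasDirDeriv L (L y) x y := by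
  refine tendsto_const_nhds.congr' ?_
  filter_upwards [self_mem_nhdsWithin] with t ht
  have ht : t ≠ 0 := ht
  simp [smul_smul, ht]

theorem HasDirDeriv.comp_clm {f : F → G} {D : G} {x y : E} {L : E →L[ℝ] F}
    (h : HasDirDeriv f D (L x) (L y)) : HasDirDeriv (fun z => f (L z)) D x y := by
  refine Tendsto.congr (fun t => ?_) h
  simp

theorem IsCkOn.continuousOn {k : ℕ} {f : E → F} {U : Set E} (h : IsCkOn k f U) :
    ContinuousOn f U := by
  cases k with
  | zero => exact h
  | succ n => exact h.1

theorem IsCkOn.mono {k : ℕ} {f : E → F} {U V : Set E} (h : IsCkOn k f U) (hVU : V ⊆ U) :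
    IsCkOn k f V := by
  induction k generalizing E with
  | zero => exact ContinuousOn.mono h hVU
  | succ n ih =>
    obtain ⟨hc, df, hd, hdf⟩ := h
    exact ⟨hc.mono hVU, df, fun x hx => hd x (hVU hx), ih hdf (prod_mono hVU Subset.rfl)⟩

theorem IsCkOn.of_succ {k : ℕ} {f : E → F} {U : Set E} (h : IsCkOn (k + 1) f U) :
    IsCkOn k f U := by
  induction k generalizing E with
  | zero => exact h.1
  | succ n ih =>
    obtain ⟨hc, df, hd, hdf⟩ := h
    exact ⟨hc, df, hd, ih hdf⟩

theorem IsCkOn.congr [ContinuousAdd E] [ContinuousSMul ℝ E] {k : ℕ} {f g : E → F} {U : Set E}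
    (h : IsCkOn k f U) (hU : IsOpen U) (hfg : EqOn f g U) : IsCkOn k g U := by
  cases k with
  | zero => exact ContinuousOn.congr h hfg.symm
  | succ n =>
    obtain ⟨hc, df, hd, hdf⟩ := h
    exact ⟨hc.congr hfg.symm, df, fun x hx y => (hd x hx y).congr_of_mem hU hx hfg, hdf⟩

theorem ContinuousLinearMap.isCkOn (k : ℕ) (L : E →L[ℝ] F) (U : Set E) : IsCkOn k L U := by
  induction k generalizing E with
  | zero => exact L.continuous.continuousOn
  | succ n ih =>
    exact ⟨L.continuous.continuousOn, L.comp (ContinuousLinearMap.snd ℝ E E),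
      fun x _ y => L.hasDirDeriv x y, ih _ _⟩

theorem isCkOn_const (k : ℕ) (c : F) (U : Set E) : IsCkOn k (fun _ => c) U := by
  have hd (x y : E) : HasDirDeriv (fun _ => c) (0 : F) x y := by
    refine tendsto_const_nhds.congr fun t => ?_
    simp
  cases k with
  | zero => exact continuousOn_const
  | succ n =>
    exact ⟨continuousOn_const, (0 : E × E →L[ℝ] F), fun x _ y => hd x y,
      ContinuousLinearMap.isCkOn n _ _⟩

theorem IsCkOn.clm_comp {k : ℕ} {f : E → F} {U : Set E} (h : IsCkOn k f U) (L : F →L[ℝ] G) :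
    IsCkOn k (fun z => L (f z)) U := by
  induction k generalizing E with
  | zero => exact L.continuous.comp_continuousOn h
  | succ n ih =>
    obtain ⟨hc, df, hd, hdf⟩ := h
    exact ⟨L.continuous.comp_continuousOn hc, fun p => L (df p),
      fun x hx y => (hd x hx y).clm_comp L, ih hdf⟩

theorem IsCkOn.comp_clm {k : ℕ} {f : F → G} {U : Set E} {V : Set F} (h : IsCkOn k f V)
    (L : E →L[ℝ] F) (hL : MapsTo L U V) : IsCkOn k (fun z => f (L z)) U := by
  induction k generalizing E F with
  | zero => exact ContinuousOn.comp h L.continuous.continuousOn hL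
  | succ n ih =>
    obtain ⟨hc, df, hd, hdf⟩ := h
    exact ⟨hc.comp L.continuous.continuousOn hL, fun p => df ((L.prodMap L) p),
      fun x hx y => (hd _ (hL hx) _).comp_clm, ih hdf _ fun p hp => ⟨hL hp.1, trivial⟩⟩

theorem IsCkOn.prodMk {k : ℕ} {f : E → F} {g : E → G} {U : Set E} (hf : IsCkOn k f U)
    (hg : IsCkOn k g U) : IsCkOn k (fun z => (f z, g z)) U := by
  induction k generalizing E with
  | zero => exact ContinuousOn.prodMk hf hg
  | succ n ih =>
    obtain ⟨hc, df, hd, hdf⟩ := hf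
    obtain ⟨hc', dg, hd', hdg⟩ := hg
    exact ⟨hc.prodMk hc', fun p => (df p, dg p),
      fun x hx y => (hd x hx y).prodMk (hd' x hx y), ih hdf hdg⟩

theorem isCkOn_pi {ι : Type*} {k : ℕ} {f : E → ι → F} {U : Set E}
    (h : ∀ i, IsCkOn k (fun z => f z i) U) : IsCkOn k f U := by
  induction k generalizing E with
  | zero => exact continuousOn_pi.2 h
  | succ n ih =>
    choose hc df hd hdf using h
    exact ⟨continuousOn_pi.2 hc, fun p i => df i p,
      fun x hx y => hasDirDeriv_pi fun i => hd i x hx y, ih hdf⟩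

theorem IsCkOn.add [ContinuousAdd F] {k : ℕ} {f g : E → F} {U : Set E} (hf : IsCkOn k f U)
    (hg : IsCkOn k g U) : IsCkOn k (fun z => f z + g z) U :=
  (hf.prodMk hg).clm_comp (ContinuousLinearMap.fst ℝ F F + ContinuousLinearMap.snd ℝ F F)

theorem IsCkOn.sub [IsTopologicalAddGroup F] {k : ℕ} {f g : E → F} {U : Set E}
    (hf : IsCkOn k f U) (hg : IsCkOn k g U) : IsCkOn k (fun z => f z - g z) U :=
  (hf.prodMk hg).clm_comp (ContinuousLinearMap.fst ℝ F F - ContinuousLinearMap.snd ℝ F F)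

/-- Limits in a Hausdorff space are unique, so the local derivatives agree and glue. -/
theorem isCkOn_of_locally [ContinuousAdd E] [ContinuousSMul ℝ E] [T2Space F] {k : ℕ} {f : E → F}
    {U : Set E} (h : ∀ x ∈ U, ∃ V, IsOpen V ∧ x ∈ V ∧ IsCkOn k f V) : IsCkOn k f U := by
  classical
  induction k generalizing E with
  | zero =>
    intro x hx
    obtain ⟨V, hV, hxV, hf⟩ := h x hx
    exact (ContinuousOn.continuousAt hf (hV.mem_nhds hxV)).continuousWithinAt
  | succ n ih =>
    have hex (x : E) (hx : x ∈ U) (y : E) : ∃ D, HasDirDeriv f D x y := by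
      obtain ⟨V, hV, hxV, hf⟩ := h x hx
      obtain ⟨hc, df, hd, hdf⟩ := hf
      exact ⟨_, hd x hxV y⟩
    let df : E × E → F := fun p =>
      if hp : ∃ D, HasDirDeriv f D p.1 p.2 then hp.choose else 0
    have hdf (x y : E) (D : F) (hD : HasDirDeriv f D x y) : df (x, y) = D := by
      have hp : ∃ D, HasDirDeriv f D x y := ⟨D, hD⟩
      have : df (x, y) = hp.choose := dif_pos hp
      rw [this]
      exact hp.choose_spec.unique hD
    refine ⟨fun x hx => ?_, df, fun x hx y => ?_, ih ?_⟩
    · obtain ⟨V, hV, hxV, hf⟩ := h x hx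
      exact (hf.continuousOn.continuousAt (hV.mem_nhds hxV)).continuousWithinAt
    · obtain ⟨D, hD⟩ := hex x hx y
      rwa [hdf x y D hD]
    · rintro ⟨x, y⟩ ⟨hx, -⟩
      obtain ⟨V, hV, hxV, hf⟩ := h x hx
      obtain ⟨hc, dg, hd, hdg⟩ := hf
      exact ⟨V ×ˢ univ, hV.prod isOpen_univ, ⟨hxV, trivial⟩,
        hdg.congr (hV.prod isOpen_univ) fun p hp => (hdf p.1 p.2 _ (hd p.1 hp.1 p.2)).symm⟩

/-- The chain rule: compositions of `C^k`-maps are `C^k`. -/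
theorem IsCkOn.comp [IsTopologicalAddGroup F] [ContinuousSMul ℝ F]
    [IsTopologicalAddGroup G] [ContinuousSMul ℝ G] [LocallyConvexSpace ℝ G]
    {k : ℕ} {f : E → F} {g : F → G} {U : Set E} {V : Set F} (hg : IsCkOn k g V)
    (hf : IsCkOn k f U) (hV : IsOpen V) (hUV : MapsTo f U V) :
    IsCkOn k (fun z => g (f z)) U := by
  induction k generalizing E F with
  | zero => exact ContinuousOn.comp hg hf hUV
  | succ n ih =>
    -- The derivative `dg (f x, df (x, y))` involves `f` as well as `df`, so `f` is also needed as a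
    -- `C^n`-map.
    have hf' := hf.of_succ
    obtain ⟨hc, df, hd, hdf⟩ := hf
    obtain ⟨hc', dg, hd', hdg⟩ := hg
    refine ⟨hc'.comp hc hUV, fun p => dg (f p.1, df p), fun x hx y =>
      (hd x hx y).comp hV (hUV hx) hd' hdg.continuousOn, ?_⟩
    refine ih hdg ((hf'.comp_clm (ContinuousLinearMap.fst ℝ E E) fun p hp => hp.1).prodMk hdf)
      (hV.prod isOpen_univ) fun p hp => ⟨hUV hp.1, trivial⟩

theorem hasDirDeriv_smul [ContinuousAdd F] [ContinuousSMul ℝ F] (x y : ℝ × F) :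
    HasDirDeriv (fun p : ℝ × F => p.1 • p.2) (x.1 • y.2 + y.1 • x.2) x y := by
  have hc : Continuous fun t : ℝ => x.1 • y.2 + y.1 • x.2 + t • y.1 • y.2 := by fun_prop
  have h0 := hc.tendsto 0
  rw [zero_smul, add_zero] at h0
  refine (h0.mono_left nhdsWithin_le_nhds).congr' ?_
  filter_upwards [self_mem_nhdsWithin] with t ht
  have ht : t ≠ 0 := ht
  simp only [Prod.fst_add, Prod.snd_add, Prod.smul_fst, Prod.smul_snd, smul_eq_mul]
  have : (x.1 + t * y.1) • (x.2 + t • y.2) - x.1 • x.2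
      = t • (x.1 • y.2 + y.1 • x.2 + t • y.1 • y.2) := by module
  rw [this, inv_smul_smul₀ ht]

theorem isCkOn_smul [ContinuousAdd F] [ContinuousSMul ℝ F] (k : ℕ) :
    IsCkOn k (fun p : ℝ × F => p.1 • p.2) univ := by
  have hc : ContinuousOn (fun p : ℝ × F => p.1 • p.2) univ := by fun_prop
  induction k with
  | zero => exact hc
  | succ n ih =>
    -- By the product rule the derivative is scalar multiplication after `A`, plus scalar
    -- multiplication after `B`, so the induction closes.
    let A : (ℝ × F) × (ℝ × F) →L[ℝ] ℝ × F :=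
      ((ContinuousLinearMap.fst ℝ ℝ F).comp (ContinuousLinearMap.fst ℝ _ _)).prod
        ((ContinuousLinearMap.snd ℝ ℝ F).comp (ContinuousLinearMap.snd ℝ _ _))
    let B : (ℝ × F) × (ℝ × F) →L[ℝ] ℝ × F :=
      ((ContinuousLinearMap.fst ℝ ℝ F).comp (ContinuousLinearMap.snd ℝ _ _)).prod
        ((ContinuousLinearMap.snd ℝ ℝ F).comp (ContinuousLinearMap.fst ℝ _ _))
    exact ⟨hc, fun q => q.1.1 • q.2.2 + q.2.1 • q.1.2, fun x _ y => hasDirDeriv_smul x y,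
      (ih.comp_clm A (mapsTo_univ _ _)).add (ih.comp_clm B (mapsTo_univ _ _))⟩

theorem IsCkOn.smul [IsTopologicalAddGroup F] [ContinuousSMul ℝ F] [LocallyConvexSpace ℝ F]
    {k : ℕ} {c : E → ℝ} {f : E → F} {U : Set E} (hc : IsCkOn k c U) (hf : IsCkOn k f U) :
    IsCkOn k (fun z => c z • f z) U :=
  (isCkOn_smul k).comp (hc.prodMk hf) isOpen_univ (mapsTo_univ _ _)

theorem ContDiff.isCkOn {k : ℕ} {h : ℝ → ℝ} (hh : ContDiff ℝ k h) : IsCkOn k h univ := by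
  induction k generalizing h with
  | zero => exact hh.continuous.continuousOn
  | succ n ih =>
    have hh' : ContDiff ℝ ((n : WithTop ℕ∞) + 1) h := by exact_mod_cast hh
    obtain ⟨hd, -, hd'⟩ := contDiff_succ_iff_deriv.1 hh'
    refine ⟨hd.continuous.continuousOn, fun p => deriv h p.1 • p.2, fun x _ y => ?_, ?_⟩
    · have h1 : HasDerivAt (fun τ : ℝ => h (x + τ * y)) (deriv h x * y) 0 := by
        have h2 : HasDerivAt (fun τ : ℝ => x + τ * y) y 0 :=
          (hasDerivAt_mul_const y).const_add x
        have h3 : HasDerivAt h (deriv h x) (x + 0 * y) := by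
          simpa using (hd x).hasDerivAt
        exact HasDerivAt.comp (0 : ℝ) h3 h2
      rw [hasDerivAt_iff_tendsto_slope_zero] at h1
      simpa [HasDirDeriv] using h1
    · exact ((ih hd').comp_clm (ContinuousLinearMap.fst ℝ ℝ ℝ) (mapsTo_univ _ _)).smul
        ((ContinuousLinearMap.snd ℝ ℝ ℝ).isCkOn n _)

end Calculus

/-! ### Charts, `C^r`-maps into locally convex spaces, bump functions -/

section Charts

variable {r : ℕ∞} {E : Type u} [AddCommGroup E] [Module ℝ E] [TopologicalSpace E]
  {M : Type w} [TopologicalSpace M] [ChartedSpace E M]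

theorem atlas_subset_crCharts [IsCrManifold r E M] : atlas E M ⊆ crCharts r E M :=
  fun φ hφ ψ hψ => ⟨IsCrManifold.compatible φ hφ ψ hψ, IsCrManifold.compatible ψ hψ φ hφ⟩

theorem restr_mem_crCharts {φ : OpenPartialHomeomorph M E} (hφ : φ ∈ crCharts r E M) (s : Set M) :
    φ.restr s ∈ crCharts r E M := fun ψ hψ =>
  ⟨fun k hk => ((hφ ψ hψ).1 k hk).mono fun _ hz => ⟨hz.1.1, hz.2⟩,
    fun k hk => ((hφ ψ hψ).2 k hk).mono fun _ hz => ⟨hz.1, hz.2.1⟩⟩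

theorem mem_crCharts_self_iff {φ : OpenPartialHomeomorph E E} :
    φ ∈ crCharts r E E ↔ IsCrOn r φ φ.source ∧ IsCrOn r φ.symm φ.target := by
  simp only [crCharts, chartedSpaceSelf_atlas, mem_ofPred_eq, forall_eq]
  rw [OpenPartialHomeomorph.trans_refl, and_comm]
  simp

theorem refl_mem_crCharts : OpenPartialHomeomorph.refl E ∈ crCharts r E E :=
  mem_crCharts_self_iff.2 ⟨fun k _ => (ContinuousLinearMap.id ℝ E).isCkOn k _,
    fun k _ => (ContinuousLinearMap.id ℝ E).isCkOn k _⟩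

variable {F : Type v} [AddCommGroup F] [Module ℝ F] [TopologicalSpace F]

theorem IsCrMap.isCkOn {f : M → F} (hf : IsCrMap r E F f) {φ : OpenPartialHomeomorph M E}
    (hφ : φ ∈ crCharts r E M) {k : ℕ} (hk : (k : ℕ∞) ≤ r) :
    IsCkOn k (fun z => f (φ.symm z)) φ.target :=
  (hf.2 φ hφ _ refl_mem_crCharts k hk).mono fun _ hz => ⟨hz, trivial⟩

/-- For maps to a locally convex space, it suffices to use the identity chart on the range. -/
theorem isCrMap_of_isCkOn [IsTopologicalAddGroup F] [ContinuousSMul ℝ F] [LocallyConvexSpace ℝ F]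
    {f : M → F} (hc : Continuous f) (hf : ∀ φ ∈ crCharts r E M, ∀ k : ℕ, (k : ℕ∞) ≤ r →
      IsCkOn k (fun z => f (φ.symm z)) φ.target) : IsCrMap r E F f :=
  ⟨hc, fun φ hφ ψ hψ k hk => ((mem_crCharts_self_iff.1 hψ).1 k hk).comp
    ((hf φ hφ k hk).mono inter_subset_left) ψ.open_source fun _ hz => hz.2⟩

theorem isCrMap_pi [IsTopologicalAddGroup F] [ContinuousSMul ℝ F] [LocallyConvexSpace ℝ F]
    {ι : Type*} {f : M → ι → F} (hf : ∀ i, IsCrMap r E F fun y => f y i) :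
    IsCrMap r E (ι → F) f :=
  isCrMap_of_isCkOn (continuous_pi fun i => (hf i).1) fun _ hφ _ hk =>
    isCkOn_pi fun i => (hf i).isCkOn hφ hk

theorem IsCrMap.prodMk [IsTopologicalAddGroup F] [ContinuousSMul ℝ F] [LocallyConvexSpace ℝ F]
    {G : Type*} [AddCommGroup G] [Module ℝ G] [TopologicalSpace G]
    [IsTopologicalAddGroup G] [ContinuousSMul ℝ G] [LocallyConvexSpace ℝ G]
    {f : M → F} {g : M → G} (hf : IsCrMap r E F f) (hg : IsCrMap r E G g) :
    IsCrMap r E (F × G) fun y => (f y, g y) :=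
  isCrMap_of_isCkOn (hf.1.prodMk hg.1) fun _ hφ _ hk =>
    (hf.isCkOn hφ hk).prodMk (hg.isCkOn hφ hk)

/-- The chart domain and the complement of the closed support form an open cover: the map is a
product of `C^r`-maps on the first and zero on the second, whatever values `φ₀` takes there. -/
theorem isCrMap_smul_chart [IsTopologicalAddGroup E] [ContinuousSMul ℝ E] [LocallyConvexSpace ℝ E]
    [T2Space E] {ξ : M → ℝ} (hξ : IsCrMap r E ℝ ξ) {φ₀ : OpenPartialHomeomorph M E}
    (hφ₀ : φ₀ ∈ atlas E M) (hs : tsupport ξ ⊆ φ₀.source) :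
    IsCrMap r E E fun y => ξ y • φ₀ y := by
  refine isCrMap_of_isCkOn (continuous_iff_continuousAt.2 fun y => ?_) fun φ hφ k hk =>
    isCkOn_of_locally fun z hz => ?_
  · by_cases hy : y ∈ φ₀.source
    · exact hξ.1.continuousAt.smul (φ₀.continuousAt hy)
    · have h0 : ξ =ᶠ[𝓝 y] 0 := notMem_tsupport_iff_eventuallyEq.1 fun h => hy (hs h)
      refine (continuousAt_const (y := (0 : E))).congr ?_
      filter_upwards [h0] with y' hy'
      simp [hy']
  · by_cases hy : φ.symm z ∈ φ₀.source
    · have hmono : (φ.symm.trans φ₀).source ⊆ φ.target := fun _ h => h.1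
      exact ⟨(φ.symm.trans φ₀).source, (φ.symm.trans φ₀).open_source, ⟨hz, hy⟩,
        ((hξ.isCkOn hφ hk).mono hmono).smul ((hφ φ₀ hφ₀).1 k hk)⟩
    · have hopen : IsOpen (φ.target ∩ φ.symm ⁻¹' (tsupport ξ)ᶜ) :=
        φ.isOpen_inter_preimage_symm (isClosed_tsupport ξ).isOpen_compl
      refine ⟨_, hopen, ⟨hz, fun h => hy (hs h)⟩, (isCkOn_const k (0 : E) _).congr hopen
        fun z' hz' => ?_⟩
      simp [image_eq_zero_of_notMem_tsupport hz'.2]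

/-- Initial neighbourhoods are finite intersections of preimages. Nonnegativity lets one sum control
all of them: if it is below 1, so is each summand. -/
theorem IsCrRegular.exists_isCrMap_lt_one_subset (hM : IsCrRegular r E M) {x : M} {W : Set M}
    (hW : W ∈ 𝓝 x) :
    ∃ f : M → ℝ, IsCrMap r E ℝ f ∧ f x = 0 ∧ (∀ y, 0 ≤ f y) ∧ {y | f y < 1} ⊆ W := by
  have hn : 𝓝 x = ⨅ f : {f : M → ℝ // IsCrMap r E ℝ f}, comap f.1 (𝓝 (f.1 x)) := by
    have h := congrArg (fun t => @nhds M t x) hM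
    simpa only [nhds_iInf, nhds_induced] using h
  rw [hn] at hW
  refine iInf_sets_induct hW ?_ ?_
  · exact ⟨fun _ => 0, isCrMap_of_isCkOn continuous_const fun _ _ k _ => isCkOn_const k 0 _,
      rfl, fun _ => le_rfl, subset_univ _⟩
  · rintro ⟨f, hf⟩ s₁ s₂ hs₁ ⟨g, hg, hgx, hg0, hgs⟩
    obtain ⟨ε, hε, hball⟩ := (Metric.nhds_basis_ball.comap f).mem_iff.1 hs₁
    have hc := hf.1
    have hc' := hg.1
    -- The added square is below 1 exactly when `f y` is within `ε` of `f x`.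
    refine ⟨fun y => g y + (ε⁻¹ • (f y - f x)) • (ε⁻¹ • (f y - f x)),
      isCrMap_of_isCkOn (by fun_prop) fun φ hφ k hk => ?_, by simp [hgx], fun y => ?_,
      fun y hy => ⟨hball ?_, hgs ?_⟩⟩
    · have h := (isCkOn_const k ε⁻¹ φ.target).smul
        ((hf.isCkOn hφ hk).sub (isCkOn_const k (f x) φ.target))
      exact (hg.isCkOn hφ hk).add (h.smul h)
    · exact add_nonneg (hg0 y) (mul_self_nonneg _)
    · have hy : g y + (ε⁻¹ * (f y - f x)) * (ε⁻¹ * (f y - f x)) < 1 := hy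
      have h1 : |ε⁻¹ * (f y - f x)| < 1 := by
        rw [← sq_lt_one_iff_abs_lt_one]
        nlinarith [hg0 y]
      rw [abs_mul, abs_of_pos (inv_pos.2 hε), inv_mul_lt_one₀ hε] at h1
      exact h1
    · have hy : g y + (ε⁻¹ * (f y - f x)) * (ε⁻¹ * (f y - f x)) < 1 := hy
      show g y < 1
      nlinarith [mul_self_nonneg (ε⁻¹ * (f y - f x))]

/-- Bump functions on a `C^r`-regular manifold. -/
theorem IsCrRegular.exists_bump (hM : IsCrRegular r E M) {x : M} {W : Set M} (hW : W ∈ 𝓝 x) :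
    ∃ ξ : M → ℝ, IsCrMap r E ℝ ξ ∧ (∀ᶠ y in 𝓝 x, ξ y = 1) ∧ tsupport ξ ⊆ W := by
  obtain ⟨f, hf, hfx, hf0, hfW⟩ := hM.exists_isCrMap_lt_one_subset hW
  have hfc := hf.1
  -- The argument is at least 1 where `f ≤ 1/4` and at most 0 where `f ≥ 1/2`, so the closed support
  -- lies in `{f ≤ 1/2}`, inside `{f < 1}`.
  refine ⟨fun y => Real.smoothTransition (2 - (4 : ℝ) • f y),
    isCrMap_of_isCkOn (Real.smoothTransition.continuous.comp (by fun_prop)) fun φ hφ k hk => ?_,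
    ?_, ?_⟩
  · have hs : ContDiff ℝ (k : WithTop ℕ∞) Real.smoothTransition :=
      Real.smoothTransition.contDiff (n := (k : ℕ∞))
    exact hs.isCkOn.comp ((isCkOn_const k (2 : ℝ) _).sub
      ((isCkOn_const k (4 : ℝ) _).smul (hf.isCkOn hφ hk))) isOpen_univ (mapsTo_univ _ _)
  · have h : ∀ᶠ y in 𝓝 x, f y < 1 / 4 :=
      hfc.continuousAt.eventually_lt_const (by rw [hfx]; norm_num)
    filter_upwards [h] with y hy
    refine Real.smoothTransition.one_of_one_le ?_
    rw [smul_eq_mul]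
    linarith
  · have hcl : IsClosed {y | f y ≤ 1 / 2} := isClosed_le hfc continuous_const
    refine (closure_minimal (fun y hy => ?_) hcl).trans fun y hy => hfW ?_
    · by_contra hn
      have hn : ¬ f y ≤ 1 / 2 := hn
      refine hy (Real.smoothTransition.zero_of_nonpos ?_)
      rw [smul_eq_mul]
      linarith
    · exact lt_of_le_of_lt (b := (1 / 2 : ℝ)) hy (by norm_num)

end Charts

/-! ### Straightening by shears -/

section Shear

variable {E : Type u} [AddCommGroup E] [Module ℝ E] [TopologicalSpace E]
  {F : Type v} [AddCommGroup F] [Module ℝ F] [TopologicalSpace F] [IsTopologicalAddGroup F]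

/-- The shear `w ↦ w + h (p w)` on `p ⁻¹' V`, for a map `h` from `V` to the kernel of `p`. -/
def shear (p : F →L[ℝ] E) (h : E → F) {V : Set E} (hV : IsOpen V) (hc : ContinuousOn h V)
    (hp : ∀ z ∈ V, p (h z) = 0) : OpenPartialHomeomorph F F where
  toFun w := w + h (p w)
  -- As `h` maps `V` into the kernel of `p`, the shear preserves `p w`, and subtracting the same
  -- term undoes it.
  invFun w := w - h (p w)
  source := p ⁻¹' V
  target := p ⁻¹' V
  map_source' w hw := by
    have hw : p w ∈ V := hw
    simpa [hp _ hw] using hw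
  map_target' w hw := by
    have hw : p w ∈ V := hw
    simpa [hp _ hw] using hw
  left_inv' w hw := by
    have hw : p w ∈ V := hw
    simp [hp _ hw]
  right_inv' w hw := by
    have hw : p w ∈ V := hw
    simp [hp _ hw]
  open_source := hV.preimage p.continuous
  open_target := hV.preimage p.continuous
  continuousOn_toFun := continuousOn_id.add (hc.comp p.continuous.continuousOn fun _ hw => hw)
  continuousOn_invFun := continuousOn_id.sub (hc.comp p.continuous.continuousOn fun _ hw => hw)

theorem shear_mem_crCharts {r : ℕ∞} {p : F →L[ℝ] E} {h : E → F} {V : Set E} (hV : IsOpen V)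
    (hc : ContinuousOn h V) (hp : ∀ z ∈ V, p (h z) = 0) (hh : IsCrOn r h V) :
    shear p h hV hc hp ∈ crCharts r F F :=
  mem_crCharts_self_iff.2
    ⟨fun k hk => ((ContinuousLinearMap.id ℝ F).isCkOn k _).add
      ((hh k hk).comp_clm p fun _ hw => hw),
    fun k hk => ((ContinuousLinearMap.id ℝ F).isCkOn k _).sub
      ((hh k hk).comp_clm p fun _ hw => hw)⟩

variable {r : ℕ∞} {M : Type w} [TopologicalSpace M] [ChartedSpace E M]

/-- A `C^r`-map is an immersion if locally a continuous linear map `p` with a continuous linear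
right inverse turns it into a chart. -/
theorem isCrImmersion_of_exists_clm_eqOn_chart {θ : M → F} (hθ : IsCrMap r E F θ)
    (h : ∀ x : M, ∃ φ ∈ crCharts r E M, x ∈ φ.source ∧ ∃ (p : F →L[ℝ] E) (j : E →L[ℝ] F),
      (∀ z, p (j z) = z) ∧ ∀ y ∈ φ.source, p (θ y) = φ y) : IsCrImmersion r E F θ := by
  refine ⟨hθ, fun x => ?_⟩
  obtain ⟨φ, hφ, hx, p, j, hpj, hpθ⟩ := h x
  have hck : IsCrOn r (fun z => j z - θ (φ.symm z)) φ.target := fun k hk =>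
    (j.isCkOn k _).sub (hθ.isCkOn hφ hk)
  have hc : ContinuousOn (fun z => j z - θ (φ.symm z)) φ.target :=
    (hck 0 zero_le).continuousOn
  have hp : ∀ z ∈ φ.target, p (j z - θ (φ.symm z)) = 0 := fun z hz => by
    rw [map_sub, hpj, hpθ _ (φ.map_target hz), φ.right_inv hz, sub_self]
  have hmem : ∀ y ∈ φ.source, θ y ∈ (shear p _ φ.open_target hc hp).source := fun y hy => by
    show p (θ y) ∈ φ.target
    rw [hpθ y hy]
    exact φ.map_source hy
  refine ⟨φ, hφ, shear p _ φ.open_target hc hp, shear_mem_crCharts _ _ _ hck, hx, hmem x hx,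
    image_subset_iff.2 hmem, j, ?_, 
    ⟨_, j.isTopCompl_range_ker_of_leftInverse p hpj⟩, fun z hz => ?_⟩
  · exact Function.LeftInverse.isEmbedding (f := p) hpj p.continuous j.continuous
  · show θ (φ.symm z) + (j (p (θ (φ.symm z))) - θ (φ.symm (p (θ (φ.symm z))))) = j z
    rw [hpθ _ (φ.map_target hz), φ.right_inv hz, add_sub_cancel]

end Shear

/-! ### The embedding -/

theorem theoremJ (r : ℕ∞) (hr : 1 ≤ r)
    (E : Type*) [AddCommGroup E] [Module ℝ E] [TopologicalSpace E] [IsTopologicalAddGroup E]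
    [ContinuousSMul ℝ E] [LocallyConvexSpace ℝ E] [T2Space E]
    (M : Type*) [TopologicalSpace M] [T2Space M] [ChartedSpace E M] [IsCrManifold r E M]
    (hM : IsCrRegular r E M) :
    ∃ θ : M → (M → E × ℝ), IsCrEmbedding r E (M → E × ℝ) θ := by
  classical
  have hbump (x : M) : ∃ ξ : M → ℝ, IsCrMap r E ℝ ξ ∧ (∀ᶠ y in 𝓝 x, ξ y = 1) ∧
      tsupport ξ ⊆ (chartAt E x).source :=
    hM.exists_bump ((chartAt E x).open_source.mem_nhds (mem_chart_source E x))
  choose ξ hξ hξ1 hξs using hbump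
  have hθ : IsCrMap r E (M → E × ℝ) fun y x => (ξ x y • chartAt E x y, ξ x y) :=
    isCrMap_pi fun x => (isCrMap_smul_chart (hξ x) (chart_mem_atlas E x) (hξs x)).prodMk (hξ x)
  -- Injectivity comes from inducing the topology, since `M` is Hausdorff.
  refine ⟨_, isCrImmersion_of_exists_clm_eqOn_chart hθ fun x => ?_, IsInducing.isEmbedding ?_⟩
  · refine ⟨(chartAt E x).restr {y | ξ x y = 1},
      restr_mem_crCharts (atlas_subset_crCharts (chart_mem_atlas E x)) _, ?_,
      (ContinuousLinearMap.fst ℝ E ℝ).comp (ContinuousLinearMap.proj x),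
      (ContinuousLinearMap.single ℝ (fun _ : M => E × ℝ) x).comp (ContinuousLinearMap.inl ℝ E ℝ),
      fun z => by simp, fun y hy => ?_⟩
    · rw [OpenPartialHomeomorph.restr_source]
      exact ⟨mem_chart_source E x, mem_interior_iff_mem_nhds.2 (hξ1 x)⟩
    · rw [OpenPartialHomeomorph.restr_source] at hy
      have h1 : ξ x y = 1 := interior_subset (s := {y | ξ x y = 1}) hy.2
      simp [h1]
  · refine isInducing_iff_nhds.2 fun x => le_antisymm hθ.1.continuousAt.le_comap fun W hW => ?_
    set φ := chartAt E x
    have hξx : ξ x x = 1 := (hξ1 x).self_of_nhds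
    -- This quotient recovers `φ` from coordinate `x`; it is continuous at `θ x` because `ξ x x =
    -- 1`.
    have hT : ContinuousAt (fun w : M → E × ℝ => (w x).2⁻¹ • (w x).1)
        (fun x' => (ξ x' x • chartAt E x' x, ξ x' x)) := by
      have hcx : Continuous fun w : M → E × ℝ => w x := continuous_apply x
      refine ContinuousAt.smul (ContinuousAt.inv₀ hcx.snd.continuousAt ?_) hcx.fst.continuousAt
      simp [hξx]
    have hW' : φ.target ∩ φ.symm ⁻¹' W ∈ 𝓝 (φ x) :=
      inter_mem (φ.open_target.mem_nhds (mem_chart_target E x))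
        ((φ.continuousAt_symm (mem_chart_target E x)) (by rwa [φ.left_inv (mem_chart_source E x)]))
    -- The condition `(w x).2 ≠ 0` puts `y` in the support of `ξ x`, hence in the chart domain,
    -- where `φ.symm` inverts `φ`.
    refine ⟨{w | (w x).2 ≠ 0 ∧ (w x).2⁻¹ • (w x).1 ∈ φ.target ∩ φ.symm ⁻¹' W}, ?_, ?_⟩
    · refine inter_mem ?_ (hT (show φ.target ∩ φ.symm ⁻¹' W ∈ 𝓝 ((ξ x x)⁻¹ • ξ x x • φ x) by
        rwa [hξx, inv_one, one_smul, one_smul]))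
      have hopen : IsOpen {w : M → E × ℝ | (w x).2 ≠ 0} :=
        isOpen_ne_fun (by fun_prop) continuous_const
      exact hopen.mem_nhds (by simp [hξx])
    · rintro y ⟨hy0, hyW⟩
      have hy0 : ξ x y ≠ 0 := hy0
      have hys : y ∈ φ.source := hξs x (subset_tsupport _ hy0)
      have hyW : φ.symm ((ξ x y)⁻¹ • ξ x y • φ y) ∈ W := hyW.2
      rwa [inv_smul_smul₀ hy0, φ.left_inv hys] at hyW
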